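/- For integers $n,k\ge 1$ let $\mathcal K_k^n$ be the family of the $k^n$ closed cubes $\prod_{s=1}^n\left[\frac{i_s-1}{k},\frac{i_s}{k}\right]$, $i_s\in\{1,\dots,k\}$, into which $I^n=[0,1]^n$ is divided. A set $S\subset I^n$ connects some opposite faces of $I^n$ if $S$ is connected and, for some $i\in\{1,\dots,n\}$, contains a point with $i$th coordinate $0$ and a point with $i$th coordinate $1$. A set $P\subset\mathbb Z^{n-1}$ is $1$-connected if any two of its points can be joined by a finite sequence of points of $P$ whose consecutive terms are at $\ell^\infty$-distance at most $1$. For $0\le m\le n-1$ let $\widehat C_{n,m}$ denote the minimum of the real constants $C>0$ with the following property: for every integer $k\ge1$ and every $F\colon\mathcal K_k^n\to\mathbb Z^{n-1}$ such that $\|F(K_1)-F(K_2)\|_\infty\le 1$ whenever $\dim(K_1\cap K_2)\ge m$ (topological dimension), there exist a $1$-connected set $P\subset\mathbb Z^{n-1}$ with $|P|\le C$ and a family $\mathcal S\subset F^{-1}[P]$ such that $\bigcup\mathcal S$ connects some opposite faces of $I^n$. **Proposition.** In dimension $2$ these minima exist and $\widehat C_{2,0}=\widehat C_{2,1}=1$.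 In particular, for every $k\ge 1$ and every integer-valued coloring $F$ of the $k\times k$ squares of $\mathcal K_k^2$ in which the values on any two squares sharing an edge differ by at most $1$, there are a value $p\in\mathbb Z$ and a family $\mathcal S\subset F^{-1}[\{p\}]$ of squares such that $\bigcup\mathcal S$ connects some opposite sides of $I^2$. -/

import Mathlib

/-- The cube of side length `1 / k` with (zero-based) index `i` in the division of the unit cube
`[0, 1]ⁿ` into `kⁿ` cubes. -/
def gridCube (n k : ℕ) (i : Fin n → Fin k) : Set (Fin n → ℝ) :=
  {x | ∀ s, ((i s : ℕ) : ℝ) / (k : ℝ) ≤ x s ∧ x s ≤ (((i s : ℕ) : ℝ) + 1) / (k : ℝ)}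

/-- The family of the `kⁿ` cubes into which `[0, 1]ⁿ` is divided. -/
def cubeFamily (n k : ℕ) : Set (Set (Fin n → ℝ)) :=
  Set.range (gridCube n k)

/-- `S ⊆ [0, 1]ⁿ` is connected and meets both faces `{z s = 0}` and `{z s = 1}` of the unit cube. -/
def ConnectsOppositeFaces (n : ℕ) (s : Fin n) (S : Set (Fin n → ℝ)) : Prop :=
  S ⊆ Set.Icc 0 1 ∧ IsConnected S ∧ (∃ z ∈ S, z s = 0) ∧ (∃ z ∈ S, z s = 1)

/-- `S` connects the `s`-th opposite faces of `[0, 1]ⁿ` for some `s`. -/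
def ConnectsSomeOppositeFaces (n : ℕ) (S : Set (Fin n → ℝ)) : Prop :=
  ∃ s : Fin n, ConnectsOppositeFaces n s S

/-- `S` is `r`-connected: any two of its points are joined by a finite sequence of points of `S`
whose consecutive members are at distance at most `r`. -/
def IsRConnected {X : Type*} [MetricSpace X] (r : ℝ) (S : Set X) : Prop :=
  ∀ x ∈ S, ∀ y ∈ S, ∃ (N : ℕ) (p : Fin (N + 1) → X),
    (∀ j, p j ∈ S) ∧ p 0 = x ∧ p (Fin.last N) = y ∧
      ∀ j : Fin N, dist (p j.castSucc) (p j.succ) ≤ r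

/-- The property of a constant `C`: for every `k ≥ 1` and every `F` from the cubes to `ℤⁿ⁻¹`
whose values on cubes meeting in dimension at least `m` are at `ℓ^∞`-distance at most `1`, there
are a `1`-connected set `P` of at most `C` lattice points and a family of cubes with values in `P`
whose union connects some opposite faces. -/
def HasConnectingProperty (n m : ℕ) (C : ℝ) : Prop :=
  ∀ k : ℕ, 1 ≤ k → ∀ F : cubeFamily n k → (Fin (n - 1) → ℤ),
    (∀ K₁ K₂ : cubeFamily n k,
      (m : WithBot ℕ∞) ≤
          smallInductiveDimension ((K₁ : Set (Fin n → ℝ)) ∩ (K₂ : Set (Fin n → ℝ)) : Set _) →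
        ‖F K₁ - F K₂‖ ≤ 1) →
    ∃ P : Set (Fin (n - 1) → ℤ), IsRConnected 1 P ∧ P.Finite ∧ (P.ncard : ℝ) ≤ C ∧
      ∃ 𝒮 : Set (cubeFamily n k), 𝒮 ⊆ F ⁻¹' P ∧
        ConnectsSomeOppositeFaces n (⋃ K ∈ 𝒮, (K : Set (Fin n → ℝ)))

/-- `c` is the minimum constant `C > 0` with the connecting property for `(n, m)`. -/
def IsOptimalConstant (n m : ℕ) (c : ℝ) : Prop :=
  IsLeast {C : ℝ | 0 < C ∧ HasConnectingProperty n m C} c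

/-!
Extend the colouring of the squares to the lattice `ℕ × ℕ` and replace each colour by the connected
component, under king moves, of its colour class. Around every `2 × 2` block the four components
form a closed walk that backtracks, so every antisymmetric weight of pairs of components sums to
zero around the block, hence it is the gradient of a potential, and the potential is constant on
each component.

Suppose that no component joins opposite sides. Among the components meeting the left side let `C`
be the last one met by the bottom side, and let `D` be the component that follows `C` there. Weigh a
step by its signed number of passages from `C` to `D`. Going from a square of `C` on the left side
up, then along the top, down the right side and back along the bottom to `D`, no passage occurs,
since `D` avoids the left side while `C` avoids the other two sides and the rest of the bottom. The
final step, from `D` to `C`, changes the potential by one, although it leads back to `C`.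
-/

section Potential

variable {Q A : Type*}

/-- The closed walk `a, b, d, c, a` around a square with rows `a b` and `c d` backtracks. In a
tree, where every closed walk backtracks, this holds for any corner values that vary along the sides
by at most one edge. -/
def IsDegenerateSquare (a b c d : Q) : Prop :=
  a = d ∨ b = c ∨ (a = b ∧ c = d) ∨ (a = c ∧ b = d)

theorem isDegenerateSquare_of_abs_sub_le_one {a b c d : ℤ} (hab : |a - b| ≤ 1)
    (hcd : |c - d| ≤ 1) (hac : |a - c| ≤ 1) (hbd : |b - d| ≤ 1) : IsDegenerateSquare a b c d := by
  rw [abs_le] at hab hcd hac hbd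
  unfold IsDegenerateSquare
  omega

theorem IsDegenerateSquare.add_eq_add [AddCommGroup A] {ω : Q → Q → A} (hself : ∀ x, ω x x = 0)
    (hswap : ∀ x y, ω y x = -ω x y) {a b c d : Q} (h : IsDegenerateSquare a b c d) :
    ω a b + ω b d = ω a c + ω c d := by
  obtain rfl | rfl | ⟨rfl, rfl⟩ | ⟨rfl, rfl⟩ := h
  · rw [hswap a b, hswap a c, add_neg_cancel, add_neg_cancel]
  · rfl
  · rw [hself, hself, zero_add, add_zero]
  · rw [hself, hself, zero_add, add_zero]

/-- Every unit square of the lattice `ℕ × ℕ` is degenerate for the labelling `ℓ`. -/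
def HasDegenerateSquares (ℓ : ℕ × ℕ → Q) : Prop :=
  ∀ i j, IsDegenerateSquare (ℓ (i, j)) (ℓ (i + 1, j)) (ℓ (i, j + 1)) (ℓ (i + 1, j + 1))

/-- `φ` is a discrete primitive of the weight `ω` of pairs of labels: along each lattice edge it
increases by the weight of the labels of the two ends. -/
structure IsPotential [Add A] (ω : Q → Q → A) (ℓ : ℕ × ℕ → Q) (φ : ℕ × ℕ → A) : Prop where
  right : ∀ i j, φ (i + 1, j) = φ (i, j) + ω (ℓ (i, j)) (ℓ (i + 1, j))
  up : ∀ i j, φ (i, j + 1) = φ (i, j) + ω (ℓ (i, j)) (ℓ (i, j + 1))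

theorem exists_forall_succ_eq_add [AddCommMonoid A] {h v : ℕ → ℕ → A}
    (hclosed : ∀ i j, h i j + v (i + 1) j = v i j + h i (j + 1)) :
    ∃ φ : ℕ × ℕ → A, (∀ i j, φ (i + 1, j) = φ (i, j) + h i j) ∧
      ∀ i j, φ (i, j + 1) = φ (i, j) + v i j := by
  let φ : ℕ × ℕ → A := fun x => ∑ a ∈ Finset.range x.1, h a 0 + ∑ b ∈ Finset.range x.2, v x.1 b
  have hup : ∀ i j, φ (i, j + 1) = φ (i, j) + v i j := fun i j => by
    simp only [φ, Finset.sum_range_succ, add_assoc]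
  have hright : ∀ i j, φ (i + 1, j) = φ (i, j) + h i j := fun i j => by
    induction j with
    | zero => simp only [φ, Finset.sum_range_succ, Finset.sum_range_zero, add_zero]
    | succ j ih =>
      calc
        φ (i + 1, j + 1) = φ (i, j) + (h i j + v (i + 1) j) := by rw [hup, ih, ← add_assoc]
        _ = φ (i, j) + (v i j + h i (j + 1)) := by rw [hclosed]
        _ = φ (i, j + 1) + h i (j + 1) := by rw [hup, ← add_assoc]
  exact ⟨φ, hright, hup⟩

theorem HasDegenerateSquares.exists_isPotential [AddCommGroup A] {ω : Q → Q → A}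
    (hself : ∀ x, ω x x = 0) (hswap : ∀ x y, ω y x = -ω x y) {ℓ : ℕ × ℕ → Q}
    (hℓ : HasDegenerateSquares ℓ) : ∃ φ, IsPotential ω ℓ φ :=
  let ⟨φ, hright, hup⟩ := exists_forall_succ_eq_add fun i j => (hℓ i j).add_eq_add hself hswap
  ⟨φ, hright, hup⟩

theorem eq_of_forall_succ_eq {f : ℕ → A} {m n : ℕ} (hmn : m ≤ n)
    (h : ∀ a, m ≤ a → a < n → f (a + 1) = f a) : f n = f m := by
  induction n, hmn using Nat.le_induction with
  | base => rfl
  | succ n hmn ih =>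
    rw [h n hmn n.lt_succ_self, ih fun a ha han => h a ha (han.trans n.lt_succ_self)]

namespace IsPotential

theorem row_eq [AddZeroClass A] {ω : Q → Q → A} {ℓ : ℕ × ℕ → Q} {φ : ℕ × ℕ → A}
    (hφ : IsPotential ω ℓ φ) {m n : ℕ} (hmn : m ≤ n) (j : ℕ)
    (h : ∀ i, m ≤ i → i < n → ω (ℓ (i, j)) (ℓ (i + 1, j)) = 0) : φ (n, j) = φ (m, j) :=
  eq_of_forall_succ_eq (f := fun i => φ (i, j)) hmn fun i hmi hin => by
    rw [hφ.right, h i hmi hin, add_zero]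

theorem column_eq [AddZeroClass A] {ω : Q → Q → A} {ℓ : ℕ × ℕ → Q} {φ : ℕ × ℕ → A}
    (hφ : IsPotential ω ℓ φ) (i : ℕ) {m n : ℕ} (hmn : m ≤ n)
    (h : ∀ j, m ≤ j → j < n → ω (ℓ (i, j)) (ℓ (i, j + 1)) = 0) : φ (i, n) = φ (i, m) :=
  eq_of_forall_succ_eq (f := fun j => φ (i, j)) hmn fun j hmj hjn => by
    rw [hφ.up, h j hmj hjn, add_zero]

variable [AddCommGroup A] {ω : Q → Q → A} {ℓ : ℕ × ℕ → Q} {φ : ℕ × ℕ → A}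

theorem row_step (hφ : IsPotential ω ℓ φ) (hself : ∀ x, ω x x = 0) (hswap : ∀ x y, ω y x = -ω x y)
    {i i' : ℕ} (hi : i ≤ i' + 1) (hi' : i' ≤ i + 1) (j : ℕ) :
    φ (i', j) = φ (i, j) + ω (ℓ (i, j)) (ℓ (i', j)) := by
  obtain rfl | rfl | rfl : i' = i ∨ i' = i + 1 ∨ i = i' + 1 := by omega
  · rw [hself, add_zero]
  · exact hφ.right i j
  · rw [hφ.right, hswap, neg_add_cancel_right]

theorem column_step (hφ : IsPotential ω ℓ φ) (hself : ∀ x, ω x x = 0)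
    (hswap : ∀ x y, ω y x = -ω x y) (i : ℕ) {j j' : ℕ} (hj : j ≤ j' + 1) (hj' : j' ≤ j + 1) :
    φ (i, j') = φ (i, j) + ω (ℓ (i, j)) (ℓ (i, j')) := by
  obtain rfl | rfl | rfl : j' = j ∨ j' = j + 1 ∨ j = j' + 1 := by omega
  · rw [hself, add_zero]
  · exact hφ.up i j
  · rw [hφ.up, hswap, neg_add_cancel_right]

end IsPotential

end Potential

section Component

variable {α A : Type*}

/-- The graph of king moves of the lattice `ℕ × ℕ` between cells of the same colour. Its components
are the connected pieces of the colour classes. -/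
def monochromaticKingGraph (f : ℕ × ℕ → α) : SimpleGraph (ℕ × ℕ) where
  Adj x y := x ≠ y ∧ (x.1 ≤ y.1 + 1 ∧ y.1 ≤ x.1 + 1) ∧ (x.2 ≤ y.2 + 1 ∧ y.2 ≤ x.2 + 1) ∧ f x = f y
  symm := ⟨fun _ _ h => ⟨h.1.symm, h.2.1.symm, h.2.2.1.symm, h.2.2.2.symm⟩⟩
  loopless := ⟨fun _ h => h.1 rfl⟩

/-- The labelling of the cells by the pieces of their colour classes. -/
def monochromaticComponent (f : ℕ × ℕ → α) (x : ℕ × ℕ) :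
    (monochromaticKingGraph f).ConnectedComponent :=
  (monochromaticKingGraph f).connectedComponentMk x

theorem eq_of_connectedComponentMk_eq {V : Type*} {G : SimpleGraph V} {φ : V → A}
    (hφ : ∀ v w, G.Adj v w → φ v = φ w) {v w : V}
    (h : G.connectedComponentMk v = G.connectedComponentMk w) : φ v = φ w := by
  obtain ⟨p⟩ := SimpleGraph.ConnectedComponent.exact h
  induction p with
  | nil => rfl
  | cons hadj p ih => exact (hφ _ _ hadj).trans (ih (SimpleGraph.ConnectedComponent.sound ⟨p⟩))

theorem color_eq_of_monochromaticComponent_eq {f : ℕ × ℕ → α} {x y : ℕ × ℕ}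
    (h : monochromaticComponent f x = monochromaticComponent f y) : f x = f y :=
  eq_of_connectedComponentMk_eq (G := monochromaticKingGraph f) (fun _ _ hadj => hadj.2.2.2) h

theorem monochromaticComponent_eq_of_close {f : ℕ × ℕ → α} {x y : ℕ × ℕ}
    (h₁ : x.1 ≤ y.1 + 1 ∧ y.1 ≤ x.1 + 1) (h₂ : x.2 ≤ y.2 + 1 ∧ y.2 ≤ x.2 + 1) (h : f x = f y) :
    monochromaticComponent f x = monochromaticComponent f y := by
  by_cases hxy : x = y
  · rw [hxy]
  · exact SimpleGraph.ConnectedComponent.connectedComponentMk_eq_of_adj ⟨hxy, h₁, h₂, h⟩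

theorem hasDegenerateSquares_monochromaticComponent {f : ℕ × ℕ → α}
    (hf : HasDegenerateSquares f) : HasDegenerateSquares (monochromaticComponent f) := fun i j => by
  refine (hf i j).imp ?_ (Or.imp ?_ (Or.imp (And.imp ?_ ?_) (And.imp ?_ ?_))) <;>
  · refine monochromaticComponent_eq_of_close ?_ ?_ <;> constructor <;> dsimp only <;> omega

theorem IsPotential.eq_of_monochromaticComponent_eq [AddCommGroup A] {f : ℕ × ℕ → α}
    {ω : (monochromaticKingGraph f).ConnectedComponent →
      (monochromaticKingGraph f).ConnectedComponent → A} {φ : ℕ × ℕ → A}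
    (hφ : IsPotential ω (monochromaticComponent f) φ) (hself : ∀ x, ω x x = 0)
    (hswap : ∀ x y, ω y x = -ω x y) {x y : ℕ × ℕ}
    (h : monochromaticComponent f x = monochromaticComponent f y) : φ x = φ y := by
  refine eq_of_connectedComponentMk_eq (fun x y hadj => ?_) h
  have hxy : monochromaticComponent f x = monochromaticComponent f y :=
    SimpleGraph.ConnectedComponent.connectedComponentMk_eq_of_adj hadj
  obtain ⟨-, ⟨hx₁, hy₁⟩, ⟨hx₂, hy₂⟩, -⟩ := hadj
  rw [hφ.column_step hself hswap y.1 hx₂ hy₂, hφ.row_step hself hswap hx₁ hy₁, hxy, add_assoc,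
    hswap, neg_add_cancel, add_zero]

end Component

section Crossing

variable {Q : Type*} {C D : Q}

/-- The signed number of passages from `C` to `D` in a step from `x` to `y`. -/
noncomputable def crossing (C D x y : Q) : ℤ :=
  ({C} : Set Q).indicator 1 x * ({D} : Set Q).indicator 1 y -
    ({D} : Set Q).indicator 1 x * ({C} : Set Q).indicator 1 y

theorem crossing_self (x : Q) : crossing C D x x = 0 := by
  unfold crossing
  ring

theorem crossing_swap (x y : Q) : crossing C D y x = -crossing C D x y := by
  unfold crossing
  ring

theorem crossing_left_right (h : C ≠ D) : crossing C D C D = 1 := by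
  simp [crossing, h]

theorem crossing_eq_zero_of_ne_left {x y : Q} (hx : x ≠ C) (hy : y ≠ C) : crossing C D x y = 0 := by
  simp [crossing, hx, hy]

theorem crossing_eq_zero_of_ne_right {x y : Q} (hx : x ≠ D) (hy : y ≠ D) :
    crossing C D x y = 0 := by
  simp [crossing, hx, hy]

theorem IsPotential.boundary_eq_add_one {ℓ : ℕ × ℕ → Q} {φ : ℕ × ℕ → ℤ} {m n i j : ℕ}
    (hφ : IsPotential (crossing (ℓ (i, 0)) (ℓ (i + 1, 0))) ℓ φ) (hi : i < m) (hj : j ≤ n)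
    (hne : ℓ (i, 0) ≠ ℓ (i + 1, 0)) (hleft : ∀ b ≤ n, ℓ (0, b) ≠ ℓ (i + 1, 0))
    (htop : ∀ a ≤ m, ℓ (a, n) ≠ ℓ (i, 0)) (hright : ∀ b ≤ n, ℓ (m, b) ≠ ℓ (i, 0))
    (hbottom : ∀ a, i < a → a ≤ m → ℓ (a, 0) ≠ ℓ (i, 0)) : φ (0, j) = φ (i, 0) + 1 :=
  calc
    φ (0, j) = φ (0, n) := .symm <| hφ.column_eq 0 hj fun b _ hb =>
      crossing_eq_zero_of_ne_right (hleft b hb.le) (hleft (b + 1) hb)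
    _ = φ (m, n) := .symm <| hφ.row_eq m.zero_le n fun a _ ha =>
      crossing_eq_zero_of_ne_left (htop a ha.le) (htop (a + 1) ha)
    _ = φ (m, 0) := hφ.column_eq m n.zero_le fun b _ hb =>
      crossing_eq_zero_of_ne_left (hright b hb.le) (hright (b + 1) hb)
    _ = φ (i + 1, 0) := hφ.row_eq hi 0 fun a hia ha =>
      crossing_eq_zero_of_ne_left (hbottom a hia ha.le) (hbottom (a + 1) (Nat.lt_succ_of_lt hia) ha)
    _ = φ (i, 0) + 1 := by rw [hφ.right, crossing_left_right hne]

end Crossing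

theorem exists_lt_forall_not_of_not {p : ℕ → Prop} {m : ℕ} (h₀ : p 0) (hm : ¬p m) :
    ∃ i < m, p i ∧ ∀ a, i < a → a ≤ m → ¬p a := by
  classical
  have hi : p (Nat.findGreatest p m) := Nat.findGreatest_spec m.zero_le h₀
  exact ⟨_, (Nat.findGreatest_le m).lt_of_ne fun h => hm (h ▸ hi), hi,
    fun _ => Nat.findGreatest_is_greatest⟩

theorem HasDegenerateSquares.exists_monochromaticComponent_connecting {α : Type*} {f : ℕ × ℕ → α}
    (hf : HasDegenerateSquares f) (m n : ℕ) :
    (∃ j ≤ n, ∃ j' ≤ n, monochromaticComponent f (0, j) = monochromaticComponent f (m, j')) ∨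
      ∃ i ≤ m, ∃ i' ≤ m, monochromaticComponent f (i, 0) = monochromaticComponent f (i', n) := by
  set ℓ := monochromaticComponent f
  by_contra! ⟨hleftright, hbottomtop⟩
  obtain ⟨i, hi, ⟨j, hj, hij⟩, hlast⟩ :=
    exists_lt_forall_not_of_not (p := fun i => ∃ j ≤ n, ℓ (0, j) = ℓ (i, 0)) (m := m)
      ⟨0, n.zero_le, rfl⟩ fun ⟨j, hj, h⟩ => hleftright j hj 0 n.zero_le h
  have hleft : ∀ b ≤ n, ℓ (0, b) ≠ ℓ (i + 1, 0) := fun b hb h =>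
    hlast (i + 1) i.lt_succ_self hi ⟨b, hb, h⟩
  obtain ⟨φ, hφ⟩ := (hasDegenerateSquares_monochromaticComponent hf).exists_isPotential
    (ω := crossing (ℓ (i, 0)) (ℓ (i + 1, 0))) crossing_self crossing_swap
  have haround : φ (0, j) = φ (i, 0) + 1 :=
    hφ.boundary_eq_add_one hi hj (hij ▸ hleft j hj) hleft
      (fun a ha => (hbottomtop i hi.le a ha).symm)
      (fun b hb h => hleftright j hj b hb (hij.trans h.symm))
      (fun a hia ha h => hlast a hia ha ⟨j, hj, hij.trans h.symm⟩)
  have hwithin : φ (0, j) = φ (i, 0) :=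
    hφ.eq_of_monochromaticComponent_eq crossing_self crossing_swap hij
  omega

section GridCube

variable {n k : ℕ}

/-- The corner of a cube of the grid with the least coordinates. -/
noncomputable def lowerCorner (i : Fin n → Fin k) : Fin n → ℝ := fun s => ((i s : ℕ) : ℝ) / k

/-- The corner of a cube of the grid with the greatest coordinates. -/
noncomputable def upperCorner (i : Fin n → Fin k) : Fin n → ℝ :=
  fun s => (((i s : ℕ) : ℝ) + 1) / k

theorem gridCube_eq_Icc (i : Fin n → Fin k) :
    gridCube n k i = Set.Icc (lowerCorner i) (upperCorner i) :=
  Set.ext fun _ => forall_and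

theorem lowerCorner_le_upperCorner {i j : Fin n → Fin k} (h : ∀ s, (i s : ℕ) ≤ j s + 1) :
    lowerCorner i ≤ upperCorner j := fun s => by
  have hs : ((i s : ℕ) : ℝ) ≤ (j s : ℕ) + 1 := by exact_mod_cast h s
  exact div_le_div_of_nonneg_right hs k.cast_nonneg

theorem lowerCorner_apply_lt_upperCorner_apply {i j : Fin n → Fin k} {s : Fin n}
    (h : (i s : ℕ) ≤ j s) : lowerCorner i s < upperCorner j s := by
  have hk : (0 : ℝ) < k := by exact_mod_cast (i s).pos
  have hs : ((i s : ℕ) : ℝ) < (j s : ℕ) + 1 := by exact_mod_cast Nat.lt_succ_of_le h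
  exact div_lt_div_of_pos_right hs hk

theorem lowerCorner_mem_gridCube (i : Fin n → Fin k) : lowerCorner i ∈ gridCube n k i := by
  rw [gridCube_eq_Icc]
  exact Set.left_mem_Icc.2 (lowerCorner_le_upperCorner fun s => Nat.le_succ _)

theorem upperCorner_mem_gridCube (i : Fin n → Fin k) : upperCorner i ∈ gridCube n k i := by
  rw [gridCube_eq_Icc]
  exact Set.right_mem_Icc.2 (lowerCorner_le_upperCorner fun s => Nat.le_succ _)

theorem isConnected_gridCube (i : Fin n → Fin k) : IsConnected (gridCube n k i) :=
  ⟨⟨_, lowerCorner_mem_gridCube i⟩, gridCube_eq_Icc i ▸ (convex_Icc _ _).isPreconnected⟩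

theorem gridCube_subset_Icc (i : Fin n → Fin k) : gridCube n k i ⊆ Set.Icc 0 1 := by
  rw [gridCube_eq_Icc]
  refine Set.Icc_subset_Icc (fun s => ?_) (fun s => ?_)
  · exact div_nonneg (Nat.cast_nonneg _) (Nat.cast_nonneg _)
  · refine div_le_one_of_le₀ ?_ (Nat.cast_nonneg _)
    exact_mod_cast Nat.succ_le_of_lt (i s).isLt

theorem gridCube_inter_eq_Icc (i j : Fin n → Fin k) :
    gridCube n k i ∩ gridCube n k j =
      Set.Icc (lowerCorner i ⊔ lowerCorner j) (upperCorner i ⊓ upperCorner j) := by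
  rw [gridCube_eq_Icc, gridCube_eq_Icc, Set.Icc_inter_Icc]

theorem sup_lowerCorner_le_inf_upperCorner {i j : Fin n → Fin k}
    (hij : ∀ s, (i s : ℕ) ≤ j s + 1 ∧ (j s : ℕ) ≤ i s + 1) :
    lowerCorner i ⊔ lowerCorner j ≤ upperCorner i ⊓ upperCorner j :=
  le_inf
    (sup_le (lowerCorner_le_upperCorner fun _ => Nat.le_succ _)
      (lowerCorner_le_upperCorner fun s => (hij s).2))
    (sup_le (lowerCorner_le_upperCorner fun s => (hij s).1)
      (lowerCorner_le_upperCorner fun _ => Nat.le_succ _))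

theorem gridCube_inter_nonempty {i j : Fin n → Fin k}
    (hij : ∀ s, (i s : ℕ) ≤ j s + 1 ∧ (j s : ℕ) ≤ i s + 1) :
    (gridCube n k i ∩ gridCube n k j).Nonempty := by
  rw [gridCube_inter_eq_Icc]
  exact Set.nonempty_Icc.2 (sup_lowerCorner_le_inf_upperCorner hij)

theorem gridCube_inter_nontrivial {i j : Fin n → Fin k}
    (hij : ∀ s, (i s : ℕ) ≤ j s + 1 ∧ (j s : ℕ) ≤ i s + 1) {s : Fin n} (hs : i s = j s) :
    (gridCube n k i ∩ gridCube n k j).Nontrivial := by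
  have hle := sup_lowerCorner_le_inf_upperCorner hij
  have hlt : lowerCorner i ⊔ lowerCorner j < upperCorner i ⊓ upperCorner j := by
    refine Pi.lt_def.2 ⟨hle, s, lt_inf_iff.2 ⟨sup_lt_iff.2 ⟨?_, ?_⟩, sup_lt_iff.2 ⟨?_, ?_⟩⟩⟩ <;>
    exact lowerCorner_apply_lt_upperCorner_apply (by simp only [hs, le_refl])
  rw [gridCube_inter_eq_Icc]
  exact Set.nontrivial_of_lt (Set.left_mem_Icc.2 hle) (Set.right_mem_Icc.2 hle) hlt

theorem one_le_smallInductiveDimension {X : Type*} [TopologicalSpace X] [T1Space X]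
    [PreconnectedSpace X] [Nontrivial X] : 1 ≤ smallInductiveDimension X := by
  by_contra! h
  have hbasis : TopologicalSpace.IsTopologicalBasis {U : Set X | IsClopen U} :=
    hasSmallInductiveDimensionLT_one_iff.1 (smallInductiveDimension_lt_iff.1 (mod_cast h))
  obtain ⟨x, y, hxy⟩ := exists_pair_ne X
  obtain ⟨U, hU, hxU, hUy⟩ :=
    hbasis.exists_subset_of_mem_open (Set.mem_compl_singleton_iff.2 hxy) isOpen_compl_singleton
  have hyU : y ∈ U := IsClopen.eq_univ hU ⟨x, hxU⟩ ▸ Set.mem_univ y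
  exact hUy hyU rfl

theorem one_le_smallInductiveDimension_gridCube_inter {i j : Fin n → Fin k}
    (hij : ∀ s, (i s : ℕ) ≤ j s + 1 ∧ (j s : ℕ) ≤ i s + 1) {s : Fin n} (hs : i s = j s) :
    1 ≤ smallInductiveDimension (gridCube n k i ∩ gridCube n k j : Set (Fin n → ℝ)) := by
  have : Nontrivial (gridCube n k i ∩ gridCube n k j : Set (Fin n → ℝ)) :=
    (gridCube_inter_nontrivial hij hs).coe_sort
  have : PreconnectedSpace (gridCube n k i ∩ gridCube n k j : Set (Fin n → ℝ)) := by
    rw [← isPreconnected_iff_preconnectedSpace, gridCube_inter_eq_Icc]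
    exact (convex_Icc _ _).isPreconnected
  exact one_le_smallInductiveDimension

theorem connectsOppositeFaces_of_mem {T : Set (Fin n → Fin k)}
    (hT : IsConnected (⋃ i ∈ T, gridCube n k i)) {s : Fin n} {i j : Fin n → Fin k} (hi : i ∈ T)
    (hj : j ∈ T) (his : (i s : ℕ) = 0) (hjs : (j s : ℕ) + 1 = k) :
    ConnectsOppositeFaces n s (⋃ i ∈ T, gridCube n k i) := by
  have hk : (k : ℝ) ≠ 0 := by exact_mod_cast (i s).pos.ne'
  refine ⟨Set.iUnion₂_subset fun i _ => gridCube_subset_Icc i, hT,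
    ⟨_, Set.mem_biUnion hi (lowerCorner_mem_gridCube i), ?_⟩,
    ⟨_, Set.mem_biUnion hj (upperCorner_mem_gridCube j), ?_⟩⟩
  · rw [lowerCorner, his, Nat.cast_zero, zero_div]
  · rw [upperCorner, div_eq_one_iff_eq hk]
    exact_mod_cast hjs

end GridCube

theorem isConnected_biUnion_supp {V X : Type*} [TopologicalSpace X] {G : SimpleGraph V}
    {s : V → Set X} (hs : ∀ v, IsConnected (s v))
    (hadj : ∀ v w, G.Adj v w → (s v ∩ s w).Nonempty) (C : G.ConnectedComponent) :
    IsConnected (⋃ v ∈ C.supp, s v) := by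
  have hC := C.connected_toSimpleGraph
  have := hC.nonempty
  rw [Set.biUnion_eq_iUnion]
  refine .iUnion_of_reflTransGen (fun v => hs v) fun v w => ?_
  have adj_le_meet : C.toSimpleGraph.Adj ≤ fun v w : C => (s v ∩ s w).Nonempty :=
    fun v w h => hadj v w h
  exact Relation.ReflTransGen.mono adj_le_meet v w
    ((SimpleGraph.reachable_iff_reflTransGen v w).1 (hC.preconnected v w))

section Coloring

variable {α : Type*}

/-- The index in the `(n + 1) × (n + 1)` grid nearest to a lattice point. -/
def clampIndex (n : ℕ) (x : ℕ × ℕ) : Fin 2 → Fin (n + 1) :=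
  ![⟨min x.1 n, by omega⟩, ⟨min x.2 n, by omega⟩]

theorem isConnected_biUnion_gridCube_clampIndex (n : ℕ) {f : ℕ × ℕ → α}
    (C : (monochromaticKingGraph f).ConnectedComponent) :
    IsConnected (⋃ i ∈ clampIndex n '' C.supp, gridCube 2 (n + 1) i) := by
  rw [Set.biUnion_image]
  refine isConnected_biUnion_supp (fun x => isConnected_gridCube _) (fun x y hxy => ?_) C
  obtain ⟨-, h₁, h₂, -⟩ := hxy
  refine gridCube_inter_nonempty (Fin.forall_fin_two.2 ?_)
  simp only [clampIndex, Matrix.cons_val_zero, Matrix.cons_val_one]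
  omega

/-- Every `2 × 2` block of squares of the `k × k` grid is degenerate for the colouring `F`. -/
def HasDegenerateBlocks {k : ℕ} (F : (Fin 2 → Fin k) → α) : Prop :=
  ∀ x x' y y' : Fin k, (x : ℕ) + 1 = x' → (y : ℕ) + 1 = y' →
    IsDegenerateSquare (F ![x, y]) (F ![x', y]) (F ![x, y']) (F ![x', y'])

theorem hasDegenerateBlocks_of_abs_sub_le_one {k : ℕ} {F : (Fin 2 → Fin k) → ℤ}
    (hF : ∀ i j : Fin 2 → Fin k,
      |((i 0 : ℕ) : ℤ) - ((j 0 : ℕ) : ℤ)| + |((i 1 : ℕ) : ℤ) - ((j 1 : ℕ) : ℤ)| = 1 →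
        |F i - F j| ≤ 1) :
    HasDegenerateBlocks F := by
  intro x x' y y' hx hy
  apply isDegenerateSquare_of_abs_sub_le_one <;> apply hF <;> simp [← hx, ← hy]

theorem HasDegenerateBlocks.hasDegenerateSquares {n : ℕ} {F : (Fin 2 → Fin (n + 1)) → α}
    (hF : HasDegenerateBlocks F) : HasDegenerateSquares fun x => F (clampIndex n x) := by
  intro i j
  have hmin : ∀ a, n ≤ a → min (a + 1) n = min a n := by omega
  rcases le_or_gt n i with hi | hi
  · exact .inr (.inr (.inl (by simp only [clampIndex, hmin i hi, and_self])))
  rcases le_or_gt n j with hj | hj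
  · exact .inr (.inr (.inr (by simp only [clampIndex, hmin j hj, and_self])))
  · apply hF <;> dsimp only <;> omega

theorem HasDegenerateBlocks.exists_connectsSomeOppositeFaces {k : ℕ} (hk : 1 ≤ k)
    {F : (Fin 2 → Fin k) → α} (hF : HasDegenerateBlocks F) :
    ∃ p : α, ∃ T : Set (Fin 2 → Fin k), T ⊆ F ⁻¹' {p} ∧
      ConnectsSomeOppositeFaces 2 (⋃ i ∈ T, gridCube 2 k i) := by
  obtain ⟨n, rfl⟩ := Nat.exists_eq_add_of_le' hk
  set f : ℕ × ℕ → α := fun x => F (clampIndex n x)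
  have hcolor : ∀ x, clampIndex n '' (monochromaticComponent f x).supp ⊆ F ⁻¹' {f x} := by
    rintro x _ ⟨y, hy, rfl⟩
    exact color_eq_of_monochromaticComponent_eq hy
  have hconn : ∀ x, IsConnected
      (⋃ i ∈ clampIndex n '' (monochromaticComponent f x).supp, gridCube 2 (n + 1) i) :=
    fun x => isConnected_biUnion_gridCube_clampIndex n _
  obtain ⟨j, -, j', -, h⟩ | ⟨i, -, i', -, h⟩ :=
    hF.hasDegenerateSquares.exists_monochromaticComponent_connecting n n
  · exact ⟨_, _, hcolor (0, j), 0, connectsOppositeFaces_of_mem (hconn _) ⟨(0, j), rfl, rfl⟩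
      ⟨(n, j'), h.symm, rfl⟩ (Nat.zero_min n) (congrArg (· + 1) (min_self n))⟩
  · exact ⟨_, _, hcolor (i, 0), 1, connectsOppositeFaces_of_mem (hconn _) ⟨(i, 0), rfl, rfl⟩
      ⟨(i', n), h.symm, rfl⟩ (Nat.zero_min n) (congrArg (· + 1) (min_self n))⟩

end Coloring

theorem isRConnected_singleton {X : Type*} [MetricSpace X] (r : ℝ) (x : X) :
    IsRConnected r {x} := by
  rintro y rfl z hz
  exact ⟨0, fun _ => y, fun _ => rfl, rfl, hz.symm, fun j => j.elim0⟩

theorem one_le_smallInductiveDimension_inter_of_adjacent {k : ℕ} {i j : Fin 2 → Fin k}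
    (hij : |((i 0 : ℕ) : ℤ) - ((j 0 : ℕ) : ℤ)| + |((i 1 : ℕ) : ℤ) - ((j 1 : ℕ) : ℤ)| = 1) :
    1 ≤ smallInductiveDimension (gridCube 2 k i ∩ gridCube 2 k j : Set (Fin 2 → ℝ)) := by
  simp only [Int.abs_eq_natAbs] at hij
  obtain ⟨s, hs⟩ : ∃ s, i s = j s := by
    rw [Fin.exists_fin_two, Fin.ext_iff, Fin.ext_iff]
    omega
  refine one_le_smallInductiveDimension_gridCube_inter (Fin.forall_fin_two.2 ?_) hs
  omega

theorem hasConnectingProperty_two {m : ℕ} (hm : m ≤ 1) : HasConnectingProperty 2 m 1 := by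
  intro k hk F hF
  let cube : (Fin 2 → Fin k) → cubeFamily 2 k := fun i => ⟨gridCube 2 k i, i, rfl⟩
  have hblocks : HasDegenerateBlocks fun i => F (cube i) 0 :=
    hasDegenerateBlocks_of_abs_sub_le_one fun i j hij => by
      have hdim : (m : WithBot ℕ∞) ≤
          smallInductiveDimension (gridCube 2 k i ∩ gridCube 2 k j : Set (Fin 2 → ℝ)) :=
        le_trans (by exact_mod_cast hm) (one_le_smallInductiveDimension_inter_of_adjacent hij)
      have hnorm : ‖F (cube i) 0 - F (cube j) 0‖ ≤ 1 :=
        (norm_le_pi_norm _ 0).trans (hF (cube i) (cube j) hdim)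
      rw [Int.norm_eq_abs] at hnorm
      exact_mod_cast hnorm
  obtain ⟨p, T, hT, hconn⟩ := hblocks.exists_connectsSomeOppositeFaces hk
  have hconst : T ⊆ (fun i => F (cube i)) ⁻¹' {fun _ => p} := fun i hi => by
    funext s
    rw [Subsingleton.elim (α := Fin 1) s 0]
    exact hT hi
  exact ⟨{fun _ => p}, isRConnected_singleton _ _, Set.finite_singleton _, by simp, cube '' T,
    Set.image_subset_iff.2 hconst, by rwa [Set.biUnion_image]⟩

theorem HasConnectingProperty.one_le {n m : ℕ} {C : ℝ} (h : HasConnectingProperty n m C) :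
    1 ≤ C := by
  obtain ⟨P, -, hP, hC, 𝒮, h𝒮, -, -, hconn, -⟩ := h 1 le_rfl (fun _ => 0) (by simp)
  obtain ⟨x, hx⟩ := hconn.nonempty
  obtain ⟨K, hK, -⟩ := Set.mem_iUnion₂.1 hx
  have hcard : 1 ≤ P.ncard := (Set.ncard_pos hP).2 ⟨_, h𝒮 hK⟩
  exact le_trans (by exact_mod_cast hcard) hC

theorem isOptimalConstant_two {m : ℕ} (hm : m ≤ 1) : IsOptimalConstant 2 m 1 :=
  ⟨⟨one_pos, hasConnectingProperty_two hm⟩, fun _ h => h.2.one_le⟩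

theorem mainTheorem5_general.{u} :
    (∀ m ≤ 1, IsOptimalConstant 2 m 1) ∧
    (∀ (α : Type u) (k : ℕ), 1 ≤ k → ∀ F : (Fin 2 → Fin k) → α, HasDegenerateBlocks F →
      ∃ p : α, ∃ T : Set (Fin 2 → Fin k), T ⊆ F ⁻¹' {p} ∧
        ConnectsSomeOppositeFaces 2 (⋃ i ∈ T, gridCube 2 k i)) :=
  ⟨fun _ => isOptimalConstant_two, fun _ _ hk _ hF => hF.exists_connectsSomeOppositeFaces hk⟩

theorem mainTheorem5 :
    IsOptimalConstant 2 0 1 ∧ IsOptimalConstant 2 1 1 ∧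
    (∀ k : ℕ, 1 ≤ k → ∀ F : (Fin 2 → Fin k) → ℤ,
      (∀ i j : Fin 2 → Fin k,
        |((i 0 : ℕ) : ℤ) - ((j 0 : ℕ) : ℤ)| + |((i 1 : ℕ) : ℤ) - ((j 1 : ℕ) : ℤ)| = 1 →
          |F i - F j| ≤ 1) →
      ∃ p : ℤ, ∃ T : Set (Fin 2 → Fin k), T ⊆ F ⁻¹' {p} ∧
        ConnectsSomeOppositeFaces 2 (⋃ i ∈ T, gridCube 2 k i)) := by
  obtain ⟨hoptimal, hcolor⟩ := mainTheorem5_general.{0}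
  exact ⟨hoptimal 0 zero_le_one, hoptimal 1 le_rfl, fun k hk F hF =>
    hcolor ℤ k hk F (hasDegenerateBlocks_of_abs_sub_le_one hF)⟩
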